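/- Let $d_0,d_1,d_2,N$ be natural numbers, and let $X\in\mathbb{R}^{d_0\times N}$ and $Y\in\mathbb{R}^{d_2\times N}$, where $X$ has full row rank (i.e. $\operatorname{rank} X=d_0$). Consider the squared loss of a shallow linear network $$f(W_1,W_2)=\tfrac12\|W_2W_1X-Y\|_F^2,\qquad W_1\in\mathbb{R}^{d_1\times d_0},\ W_2\in\mathbb{R}^{d_2\times d_1},$$ as a function on $\mathbb{R}^{d_1d_0+d_2d_1}$. Then: 1. $f$ has no spurious local minima: no critical point of $f$ is a local minimum without being a global minimum. 2. $f$ has the strict saddle property: $f$ is twice continuously differentiable, and each critical point of $f$ is either a local minimum or a strict saddle, i.e. a critical point at which the Hessian of $f$ has a strictly negative eigenvalue. Consequently, every critical point of $f$ is either a global minimum of $f$ or a strict saddle. No condition is imposed on the layer widths $d_0,d_1,d_2$ or on $Y$. -/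

import Mathlib

namespace LinearNetwork

noncomputable section

/-! Landscape notions for a real function `h` on the Euclidean space with coordinates in `ι`. -/

section Landscape

variable {ι : Type*} [Fintype ι] [DecidableEq ι]

/-- `x` is a critical point of `h`: the gradient of `h` at `x` exists and vanishes. -/
def IsCriticalPoint (h : EuclideanSpace ℝ ι → ℝ) (x : EuclideanSpace ℝ ι) : Prop :=
  HasGradientAt h 0 x

/-- `x` is a global minimum (minimizer) of `h`. -/
def IsGlobalMin (h : EuclideanSpace ℝ ι → ℝ) (x : EuclideanSpace ℝ ι) : Prop :=
  ∀ y, h x ≤ h y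

/-- The partial derivative of `h` with respect to the coordinate `i`. -/
def partialDeriv (i : ι) (h : EuclideanSpace ℝ ι → ℝ) (x : EuclideanSpace ℝ ι) : ℝ :=
  fderiv ℝ h x (EuclideanSpace.single i 1)

/-- The Hessian matrix of `h` at `x`: the matrix of second-order partial derivatives. -/
def hessian (h : EuclideanSpace ℝ ι → ℝ) (x : EuclideanSpace ℝ ι) : Matrix ι ι ℝ :=
  Matrix.of fun i j => partialDeriv i (partialDeriv j h) x

/-- A strict saddle: a critical point at which the Hessian has a strictly negative eigenvalue. -/
def IsStrictSaddle (h : EuclideanSpace ℝ ι → ℝ) (x : EuclideanSpace ℝ ι) : Prop :=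
  IsCriticalPoint h x ∧
    ∃ c : ℝ, c < 0 ∧ Module.End.HasEigenvalue (Matrix.toLin' (hessian h x)) c

/-- The strict saddle property of a twice continuously differentiable function: each critical
point is a local minimum or a strict saddle. -/
def HasStrictSaddleProperty (h : EuclideanSpace ℝ ι → ℝ) : Prop :=
  ContDiff ℝ 2 h ∧ ∀ x, IsCriticalPoint h x → IsLocalMin h x ∨ IsStrictSaddle h x

/-- A spurious local minimum: a critical point that is a local but not a global minimum. -/
def IsSpuriousLocalMin (h : EuclideanSpace ℝ ι → ℝ) (x : EuclideanSpace ℝ ι) : Prop :=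
  IsCriticalPoint h x ∧ IsLocalMin h x ∧ ¬ IsGlobalMin h x

end Landscape

/-! The shallow linear network with layer sizes `d₀`, `d₁`, `d₂`. -/

section Network

variable {d₀ d₁ d₂ N : ℕ}

/-- The space of all weights: the entries of `W₁` (`d₁ × d₀`) and of `W₂` (`d₂ × d₁`). -/
abbrev Weights (d₀ d₁ d₂ : ℕ) : Type :=
  EuclideanSpace ℝ ((Fin d₁ × Fin d₀) ⊕ (Fin d₂ × Fin d₁))

/-- The weight matrix of the first layer. -/
def W₁ (Z : Weights d₀ d₁ d₂) : Matrix (Fin d₁) (Fin d₀) ℝ :=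
  Matrix.of fun i j => Z (Sum.inl (i, j))

/-- The weight matrix of the second layer. -/
def W₂ (Z : Weights d₀ d₁ d₂) : Matrix (Fin d₂) (Fin d₁) ℝ :=
  Matrix.of fun i j => Z (Sum.inr (i, j))

attribute [local instance] Matrix.frobeniusNormedAddCommGroup

/-- The squared loss `½ ‖W₂ W₁ X - Y‖_F²`, with the Frobenius norm. -/
def loss (X : Matrix (Fin d₀) (Fin N) ℝ) (Y : Matrix (Fin d₂) (Fin N) ℝ)
    (Z : Weights d₀ d₁ d₂) : ℝ :=
  1 / 2 * ‖W₂ Z * W₁ Z * X - Y‖ ^ 2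

end Network

end

end LinearNetwork

/-! Write A = `W₂`, B = `W₁`, R = ABX - Y. Everything reduces to `frob_le_of_second_order`: a
critical point whose second variation is nonnegative in every direction is a global minimum. Local
minima satisfy this condition, and so do critical points that are not strict saddles, because the
Hessian is symmetric; the loss along a line is a quartic whose coefficients can be compared
(`loss_line`). If Bᵀ has a kernel, rank-one variations force RXᵀ = 0, the normal equations of the
unconstrained least squares problem. Otherwise C = BX has independent rows. With P the projection to
the row space of X and G = RP, criticality makes YP = AC - G an orthogonal splitting on both sides,
and rank-one variations show that G has no singular value above those of AC on the row space of C.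
So AC is a best approximation of YP of rank at most `d₁`, in the spirit of Eckart–Young
(`frob_le_of_rank_le`). -/

namespace LinearNetwork

open Matrix Filter Topology

/-! The Frobenius inner product. -/

section Frobenius

variable {m n k : Type*} [Fintype m] [Fintype n] [Fintype k]

/-- The Frobenius inner product of two real matrices. -/
def frob (M M' : Matrix m n ℝ) : ℝ := (Mᵀ * M').trace

lemma frob_eq_sum (M M' : Matrix m n ℝ) : frob M M' = ∑ i, ∑ j, M i j * M' i j := by
  simp only [frob, trace, diag_apply, mul_apply, transpose_apply]
  exact Finset.sum_comm

lemma frob_comm (M M' : Matrix m n ℝ) : frob M M' = frob M' M := by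
  simp only [frob_eq_sum, mul_comm]

lemma frob_add_left (M M' K : Matrix m n ℝ) : frob (M + M') K = frob M K + frob M' K := by
  simp [frob, Matrix.add_mul]

lemma frob_smul_left (t : ℝ) (M K : Matrix m n ℝ) : frob (t • M) K = t * frob M K := by
  simp [frob]

lemma frob_add_right (K M M' : Matrix m n ℝ) : frob K (M + M') = frob K M + frob K M' := by
  simp [frob, Matrix.mul_add]

lemma frob_smul_right (t : ℝ) (K M : Matrix m n ℝ) : frob K (t • M) = t * frob K M := by
  simp [frob]

lemma frob_self_nonneg (M : Matrix m n ℝ) : 0 ≤ frob M M := by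
  rw [frob_eq_sum]
  exact Finset.sum_nonneg fun _ _ => Finset.sum_nonneg fun _ _ => mul_self_nonneg _

lemma frob_add_self (M K : Matrix m n ℝ) :
    frob (M + K) (M + K) = frob M M + 2 * frob M K + frob K K := by
  rw [frob_add_left, frob_add_right, frob_add_right, frob_comm K M]
  ring

lemma frob_mul_left (A : Matrix m k ℝ) (U : Matrix k n ℝ) (R : Matrix m n ℝ) :
    frob R (A * U) = frob (Aᵀ * R) U := by
  simp [frob, Matrix.transpose_mul, Matrix.mul_assoc]

lemma frob_mul_right (V : Matrix m k ℝ) (B : Matrix k n ℝ) (R : Matrix m n ℝ) :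
    frob R (V * B) = frob (R * Bᵀ) V := by
  simp only [frob, Matrix.transpose_mul, Matrix.transpose_transpose]
  rw [← Matrix.mul_assoc, Matrix.trace_mul_comm, Matrix.mul_assoc]

lemma frob_vecMulVec_right (R : Matrix m n ℝ) (v : m → ℝ) (w : n → ℝ) :
    frob R (vecMulVec v w) = v ⬝ᵥ (R *ᵥ w) := by
  simp only [frob_eq_sum, vecMulVec_apply, dotProduct, mulVec, Finset.mul_sum]
  exact Finset.sum_congr rfl fun i _ => Finset.sum_congr rfl fun j _ => by ring

lemma frob_vecMulVec (v v' : m → ℝ) (w w' : n → ℝ) :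
    frob (vecMulVec v w) (vecMulVec v' w') = (v ⬝ᵥ v') * (w ⬝ᵥ w') := by
  rw [frob_vecMulVec_right, vecMulVec_mulVec]
  simp [dotProduct_smul, dotProduct_comm v' v, mul_comm]

/-- The squared Frobenius norm as a sum over an orthonormal basis. -/
lemma frob_self_eq_sum_col [DecidableEq n] (M : Matrix m n ℝ) (U : Matrix n n ℝ)
    (hU : U * Uᵀ = 1) :
    frob M M = ∑ i, (M *ᵥ U.col i) ⬝ᵥ (M *ᵥ U.col i) := by
  have h1 : frob M M = frob (M * U) (M * U) := by
    rw [frob_mul_right, Matrix.mul_assoc, hU, Matrix.mul_one]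
  rw [h1, frob_eq_sum, Finset.sum_comm]
  rfl

end Frobenius

/-! ### Dot products of real vectors. -/

section Vectors

variable {m n : Type*} [Fintype m] [Fintype n]

lemma dotProduct_self_nonneg' (x : n → ℝ) : 0 ≤ x ⬝ᵥ x :=
  Finset.sum_nonneg fun _ _ => mul_self_nonneg _

lemma dotProduct_self_pos' {x : n → ℝ} (hx : x ≠ 0) : 0 < x ⬝ᵥ x :=
  lt_of_le_of_ne (dotProduct_self_nonneg' x) fun h => hx (dotProduct_self_eq_zero.mp h.symm)

lemma mulVec_dotProduct (A : Matrix m n ℝ) (x : n → ℝ) (y : m → ℝ) :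
    (A *ᵥ x) ⬝ᵥ y = x ⬝ᵥ (Aᵀ *ᵥ y) := by
  rw [dotProduct_comm, dotProduct_mulVec, dotProduct_comm, ← mulVec_transpose]

/-- A linear function of `t` that is bounded below is constant. -/
lemma eq_zero_of_forall_add_mul_nonneg {p q : ℝ} (h : ∀ t : ℝ, 0 ≤ p + t * q) : q = 0 := by
  by_contra hq
  have := h (-(p + 1) / q)
  rw [div_mul_cancel₀ _ hq] at this
  linarith

end Vectors

/-! Orthogonal projection to the row space of a matrix of full row rank. -/

section RowProj

variable {m n k : Type*} [Fintype m] [Fintype n] [DecidableEq m] [Fintype k]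

/-- The orthogonal projection to the row space of `C`, when the rows are independent. -/
noncomputable def rowProj (C : Matrix m n ℝ) : Matrix n n ℝ := Cᵀ * (C * Cᵀ)⁻¹ * C

lemma isUnit_det_mul_transpose {C : Matrix m n ℝ} (h : ∀ w, Cᵀ *ᵥ w = 0 → w = 0) :
    IsUnit (C * Cᵀ).det := by
  rw [← Matrix.isUnit_iff_isUnit_det, ← Matrix.mulVec_injective_iff_isUnit]
  intro x y hxy
  have h0 : (C * Cᵀ) *ᵥ (x - y) = 0 := by rw [mulVec_sub]; exact sub_eq_zero.mpr hxy
  have h1 : (Cᵀ *ᵥ (x - y)) ⬝ᵥ (Cᵀ *ᵥ (x - y)) = 0 := by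
    rw [mulVec_dotProduct, mulVec_mulVec, transpose_transpose, h0, dotProduct_zero]
  exact sub_eq_zero.mp (h _ (dotProduct_self_eq_zero.mp h1))

lemma transpose_rowProj (C : Matrix m n ℝ) : (rowProj C)ᵀ = rowProj C := by
  simp [rowProj, Matrix.transpose_mul, Matrix.transpose_nonsing_inv, Matrix.mul_assoc]

lemma mul_rowProj {C : Matrix m n ℝ} (h : IsUnit (C * Cᵀ).det) : C * rowProj C = C := by
  rw [rowProj, ← Matrix.mul_assoc, ← Matrix.mul_assoc, Matrix.mul_nonsing_inv _ h, Matrix.one_mul]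

lemma rowProj_mul_transpose {C : Matrix m n ℝ} (h : IsUnit (C * Cᵀ).det) :
    rowProj C * Cᵀ = Cᵀ := by
  rw [← transpose_rowProj, ← Matrix.transpose_mul, mul_rowProj h]

lemma rowProj_mul_self {C : Matrix m n ℝ} (h : IsUnit (C * Cᵀ).det) :
    rowProj C * rowProj C = rowProj C := by
  nth_rw 1 [rowProj]
  rw [Matrix.mul_assoc, mul_rowProj h, rowProj]

lemma trace_rowProj {C : Matrix m n ℝ} (h : IsUnit (C * Cᵀ).det) :
    (rowProj C).trace = Fintype.card m := by
  rw [rowProj, Matrix.trace_mul_comm, ← Matrix.mul_assoc, Matrix.mul_nonsing_inv _ h, trace_one]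

lemma rowProj_mulVec (C : Matrix m n ℝ) (x : n → ℝ) :
    rowProj C *ᵥ x = Cᵀ *ᵥ (((C * Cᵀ)⁻¹ * C) *ᵥ x) := by
  rw [mulVec_mulVec, rowProj, Matrix.mul_assoc]

lemma rowProj_pythagoras {C : Matrix m n ℝ} (h : IsUnit (C * Cᵀ).det) (x : n → ℝ) :
    (x - rowProj C *ᵥ x) ⬝ᵥ (x - rowProj C *ᵥ x)
      = x ⬝ᵥ x - (rowProj C *ᵥ x) ⬝ᵥ (rowProj C *ᵥ x) := by
  have h1 : (rowProj C *ᵥ x) ⬝ᵥ (rowProj C *ᵥ x) = x ⬝ᵥ (rowProj C *ᵥ x) := by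
    rw [mulVec_dotProduct, transpose_rowProj, mulVec_mulVec, rowProj_mul_self h]
  rw [sub_dotProduct, dotProduct_sub, dotProduct_sub, h1, dotProduct_comm (rowProj C *ᵥ x) x]
  ring

lemma rowProj_contraction {C : Matrix m n ℝ} (h : IsUnit (C * Cᵀ).det) (x : n → ℝ) :
    (rowProj C *ᵥ x) ⬝ᵥ (rowProj C *ᵥ x) ≤ x ⬝ᵥ x := by
  linarith [rowProj_pythagoras h x, dotProduct_self_nonneg' (x - rowProj C *ᵥ x)]

/-- An orthonormal basis of which at most `rank Q` vectors lie outside the kernel of `Q`. -/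
lemma exists_orthogonal_adapted [DecidableEq n] (Q : Matrix k n ℝ) :
    ∃ (U : Matrix n n ℝ) (I : Finset n), U * Uᵀ = 1 ∧ Uᵀ * U = 1 ∧ I.card = Q.rank ∧
      ∀ i ∉ I, Q *ᵥ U.col i = 0 := by
  have hS : (Qᵀ * Q).IsHermitian := by
    rw [← conjTranspose_eq_transpose_of_trivial]
    exact isHermitian_conjTranspose_mul_self Q
  -- An eigenbasis of QᵀQ works, since QᵀQ and Q have the same kernel and rank.
  refine ⟨hS.eigenvectorUnitary, Finset.univ.filter fun i => hS.eigenvalues i ≠ 0, ?_, ?_, ?_, ?_⟩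
  · exact (mem_unitaryGroup_iff.mp hS.eigenvectorUnitary.2 :)
  · exact (mem_unitaryGroup_iff'.mp hS.eigenvectorUnitary.2 :)
  · rw [← Matrix.rank_transpose_mul_self Q, hS.rank_eq_card_non_zero_eigs, Fintype.card_subtype]
  · intro i hi
    have h0 : hS.eigenvalues i = 0 := by simpa using hi
    have h1 := hS.mulVec_eigenvectorBasis i
    rw [h0, zero_smul] at h1
    have h2 : (hS.eigenvectorUnitary : Matrix n n ℝ).col i = hS.eigenvectorBasis i := by
      ext j; rfl
    rw [h2]
    apply dotProduct_self_eq_zero.mp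
    rw [mulVec_dotProduct, mulVec_mulVec, h1, dotProduct_zero]

/-- Low rank approximation: if `G` is orthogonal to `A * C` on both sides and its singular values
are at most those of `A * C`, then `A * C` is a best approximation of `A * C - G` among the
matrices whose rank is at most that of `C`. -/
lemma frob_le_of_rank_le [DecidableEq n] {A : Matrix k m ℝ} {C : Matrix m n ℝ} {G Q : Matrix k n ℝ}
    (hC : IsUnit (C * Cᵀ).det) (hAG : Aᵀ * G = 0) (hGC : G * Cᵀ = 0) {c : ℝ} (hc : 0 ≤ c)
    (hG : ∀ u, (G *ᵥ u) ⬝ᵥ (G *ᵥ u) ≤ c * (u ⬝ᵥ u))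
    (hAC : ∀ a, c * ((Cᵀ *ᵥ a) ⬝ᵥ (Cᵀ *ᵥ a))
      ≤ (A *ᵥ (C *ᵥ (Cᵀ *ᵥ a))) ⬝ᵥ (A *ᵥ (C *ᵥ (Cᵀ *ᵥ a))))
    (hQ : Q.rank ≤ Fintype.card m) :
    frob G G ≤ frob (Q - (A * C - G)) (Q - (A * C - G)) := by
  obtain ⟨U, I, hU, hU', hI, hI0⟩ := exists_orthogonal_adapted Q
  set P := rowProj C with hP
  set e : n → n → ℝ := U.col with he
  have hen (i) : e i ⬝ᵥ e i = 1 := by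
    have := congrFun (congrFun hU' i) i
    simpa [Matrix.mul_apply, dotProduct, he] using this
  have hGP : G * P = 0 := by
    rw [hP, rowProj, ← Matrix.mul_assoc, ← Matrix.mul_assoc, hGC, Matrix.zero_mul, Matrix.zero_mul]
  have hGe (i) : (G *ᵥ e i) ⬝ᵥ (G *ᵥ e i) ≤ c * (1 - (P *ᵥ e i) ⬝ᵥ (P *ᵥ e i)) := by
    have h1 : G *ᵥ e i = G *ᵥ (e i - P *ᵥ e i) := by
      rw [mulVec_sub, mulVec_mulVec, hGP, zero_mulVec, sub_zero]
    rw [h1, ← hen i, ← rowProj_pythagoras hC]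
    exact hG _
  have hACe (i) : c * ((P *ᵥ e i) ⬝ᵥ (P *ᵥ e i)) ≤ (A *ᵥ (C *ᵥ e i)) ⬝ᵥ (A *ᵥ (C *ᵥ e i)) := by
    have h1 : C *ᵥ e i = C *ᵥ (P *ᵥ e i) := by rw [mulVec_mulVec, mul_rowProj hC]
    rw [h1, hP, rowProj_mulVec]
    exact hAC _
  have hMe (i) : ((A * C - G) *ᵥ e i) ⬝ᵥ ((A * C - G) *ᵥ e i)
      = (A *ᵥ (C *ᵥ e i)) ⬝ᵥ (A *ᵥ (C *ᵥ e i)) + (G *ᵥ e i) ⬝ᵥ (G *ᵥ e i) := by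
    have h1 : (A *ᵥ (C *ᵥ e i)) ⬝ᵥ (G *ᵥ e i) = 0 := by
      rw [mulVec_dotProduct, mulVec_mulVec, hAG, zero_mulVec, dotProduct_zero]
    rw [sub_mulVec, ← mulVec_mulVec, sub_dotProduct, dotProduct_sub, dotProduct_sub,
      dotProduct_comm (G *ᵥ e i), h1]
    ring
  -- The squared lengths of the projected basis add up to the trace of P, that is, to the number of
  -- rows of C.
  have hPt : ∑ i, (P *ᵥ e i) ⬝ᵥ (P *ᵥ e i) = Fintype.card m := by
    rw [← frob_self_eq_sum_col P U hU, frob, transpose_rowProj, rowProj_mul_self hC,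
      trace_rowProj hC]
  rw [frob_self_eq_sum_col _ U hU, frob_self_eq_sum_col (Q - (A * C - G)) U hU]
  have key (i) : (G *ᵥ e i) ⬝ᵥ (G *ᵥ e i)
      + (c * ((P *ᵥ e i) ⬝ᵥ (P *ᵥ e i)) - if i ∈ I then c else 0)
      ≤ ((Q - (A * C - G)) *ᵥ e i) ⬝ᵥ ((Q - (A * C - G)) *ᵥ e i) := by
    -- On I the right side is only bounded by 0, at a cost of at most c per vector. Off I the vector
    -- lies in the kernel of Q, so the full length of (AC - G)e survives. In total the gain is c
    -- times (card m - rank Q), which is nonnegative.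
    by_cases hi : i ∈ I
    · rw [if_pos hi]
      linarith [hGe i, dotProduct_self_nonneg' ((Q - (A * C - G)) *ᵥ e i)]
    · rw [if_neg hi, sub_mulVec, hI0 i hi, zero_sub, neg_dotProduct, dotProduct_neg, neg_neg, hMe]
      linarith [hACe i]
  have hsum := Finset.sum_le_sum fun i (_ : i ∈ Finset.univ) => key i
  rw [Finset.sum_add_distrib, Finset.sum_sub_distrib, ← Finset.mul_sum, hPt,
    Finset.sum_ite_mem, Finset.univ_inter, Finset.sum_const, hI, nsmul_eq_mul] at hsum
  have : (Q.rank : ℝ) ≤ Fintype.card m := by exact_mod_cast hQ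
  nlinarith [mul_le_mul_of_nonneg_left this hc]

end RowProj

/-! ### Second-order critical points are global minima, in matrix form. -/

section MatrixLandscape

variable {m n k l : Type*} [Fintype m] [Fintype n] [Fintype k] [Fintype l]

/-- The normal equations of linear least squares. -/
lemma frob_sub_le_of_mul_transpose_eq_zero {X : Matrix l n ℝ} {Y : Matrix k n ℝ}
    {P : Matrix k l ℝ} (h : (P * X - Y) * Xᵀ = 0) (Q : Matrix k l ℝ) :
    frob (P * X - Y) (P * X - Y) ≤ frob (Q * X - Y) (Q * X - Y) := by
  have h1 : Q * X - Y = (P * X - Y) + (Q - P) * X := by rw [Matrix.sub_mul]; abel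
  have h2 : frob (P * X - Y) ((Q - P) * X) = 0 := by
    rw [frob_mul_right, h]; simp [frob]
  rw [h1, frob_add_self, h2]
  linarith [frob_self_nonneg ((Q - P) * X)]

/-- The second-order condition in the directions of matrices of rank one. -/
lemma second_order_vecMulVec {A : Matrix k m ℝ} {B : Matrix m l ℝ} {X : Matrix l n ℝ}
    {R : Matrix k n ℝ}
    (h : ∀ (U : Matrix m l ℝ) (V : Matrix k m ℝ),
      0 ≤ frob ((V * B + A * U) * X) ((V * B + A * U) * X) + 2 * frob R (V * U * X))
    (v : k → ℝ) (a b : m → ℝ) (u : l → ℝ) :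
    0 ≤ (v ⬝ᵥ v) * (((B * X)ᵀ *ᵥ a) ⬝ᵥ ((B * X)ᵀ *ᵥ a))
      + 2 * ((v ⬝ᵥ (A *ᵥ b)) * (((B * X)ᵀ *ᵥ a) ⬝ᵥ (Xᵀ *ᵥ u)))
      + ((A *ᵥ b) ⬝ᵥ (A *ᵥ b)) * ((Xᵀ *ᵥ u) ⬝ᵥ (Xᵀ *ᵥ u))
      + 2 * ((a ⬝ᵥ b) * (v ⬝ᵥ ((R * Xᵀ) *ᵥ u))) := by
  have h1 := h (vecMulVec b u) (vecMulVec v a)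
  have e1 : (vecMulVec v a * B + A * vecMulVec b u) * X
      = vecMulVec v ((B * X)ᵀ *ᵥ a) + vecMulVec (A *ᵥ b) (Xᵀ *ᵥ u) := by
    rw [Matrix.add_mul, Matrix.mul_assoc, vecMulVec_mul, mul_vecMulVec, vecMulVec_mul,
      mulVec_transpose, mulVec_transpose]
  have e2 : vecMulVec v a * vecMulVec b u * X = (a ⬝ᵥ b) • vecMulVec v (Xᵀ *ᵥ u) := by
    rw [vecMulVec_mul_vecMulVec, vecMulVec_mul, mulVec_transpose]
    ext i j
    simp [vecMulVec_apply, smul_vecMul]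
    ring
  rw [e1, e2, frob_add_self, frob_vecMulVec, frob_vecMulVec, frob_vecMulVec, frob_smul_right,
    frob_vecMulVec_right, mulVec_mulVec] at h1
  linarith

lemma eq_zero_of_forall_dotProduct_mulVec [DecidableEq l] {M : Matrix k l ℝ}
    (h : ∀ (v : k → ℝ) (u : l → ℝ), v ⬝ᵥ (M *ᵥ u) = 0) : M = 0 := by
  ext i j
  have h1 : M *ᵥ Pi.single j 1 = 0 := dotProduct_self_eq_zero.mp (h _ _)
  simpa using congrFun h1 i

/-- A critical point of the loss at which the second-order necessary condition holds is a global
minimum. -/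
theorem frob_le_of_second_order [DecidableEq m] [DecidableEq n] [DecidableEq l]
    {A : Matrix k m ℝ} {B : Matrix m l ℝ} {X : Matrix l n ℝ}
    {Y : Matrix k n ℝ} (hX : ∀ w, Xᵀ *ᵥ w = 0 → w = 0)
    (hU : Aᵀ * ((A * B * X - Y) * Xᵀ) = 0) (hV : (A * B * X - Y) * Xᵀ * Bᵀ = 0)
    (h : ∀ (U : Matrix m l ℝ) (V : Matrix k m ℝ),
      0 ≤ frob ((V * B + A * U) * X) ((V * B + A * U) * X)
        + 2 * frob (A * B * X - Y) (V * U * X))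
    (A' : Matrix k m ℝ) (B' : Matrix m l ℝ) :
    frob (A * B * X - Y) (A * B * X - Y) ≤ frob (A' * B' * X - Y) (A' * B' * X - Y) := by
  set R := A * B * X - Y with hR
  have h1 := second_order_vecMulVec h
  by_cases hB : ∃ w, Bᵀ *ᵥ w = 0 ∧ w ≠ 0
  · obtain ⟨w, hw, hw0⟩ := hB
    refine frob_sub_le_of_mul_transpose_eq_zero (eq_zero_of_forall_dotProduct_mulVec fun v u => ?_) _
    have hCw : (B * X)ᵀ *ᵥ w = 0 := by
      rw [Matrix.transpose_mul, ← mulVec_mulVec, hw, mulVec_zero]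
    -- With V = t v wᵀ and U = w uᵀ, VB vanishes, so the second variation is affine in t.
    have h2 : 2 * ((w ⬝ᵥ w) * (v ⬝ᵥ ((R * Xᵀ) *ᵥ u))) = 0 := by
      refine eq_zero_of_forall_add_mul_nonneg
        (p := ((A *ᵥ w) ⬝ᵥ (A *ᵥ w)) * ((Xᵀ *ᵥ u) ⬝ᵥ (Xᵀ *ᵥ u))) fun t => ?_
      have := h1 (t • v) w w u
      rw [hCw] at this
      simp only [dotProduct_zero, zero_dotProduct, smul_dotProduct, smul_eq_mul] at this
      linarith
    have := (dotProduct_self_pos' hw0).ne'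
    simpa [this] using h2
  push Not at hB
  -- For empty m the infimum chosen for c below would range over the empty set; here all factors
  -- coincide anyway.
  rcases isEmpty_or_nonempty m with hm | hm
  · rw [hR, Subsingleton.elim A A', Subsingleton.elim B B']
  set C := B * X with hCdef
  have hCinj : ∀ w, Cᵀ *ᵥ w = 0 → w = 0 := fun w hw => hB w (hX _ (by
    rwa [hCdef, Matrix.transpose_mul, ← mulVec_mulVec] at hw))
  have hC := isUnit_det_mul_transpose hCinj
  have hXu := isUnit_det_mul_transpose hX
  set P := rowProj X with hP
  set G := R * P with hG
  have hAG : Aᵀ * G = 0 := by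
    rw [hG, hP, rowProj, Matrix.mul_assoc Xᵀ, ← Matrix.mul_assoc R, ← Matrix.mul_assoc, hU,
      Matrix.zero_mul]
  have hGC : G * Cᵀ = 0 := by
    rw [hG, hCdef, Matrix.transpose_mul, Matrix.mul_assoc, ← Matrix.mul_assoc P, hP,
      rowProj_mul_transpose hXu, ← Matrix.mul_assoc, hV]
  have hM : A * C - G = Y * P := by
    rw [hG, hR, Matrix.sub_mul, hCdef, Matrix.mul_assoc (A * B), hP, mul_rowProj hXu,
      Matrix.mul_assoc A]
    abel
  have hcomp (u : n → ℝ) (a : m → ℝ) : ((G *ᵥ u) ⬝ᵥ (G *ᵥ u)) * ((Cᵀ *ᵥ a) ⬝ᵥ (Cᵀ *ᵥ a))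
      ≤ ((A *ᵥ (C *ᵥ (Cᵀ *ᵥ a))) ⬝ᵥ (A *ᵥ (C *ᵥ (Cᵀ *ᵥ a)))) * (u ⬝ᵥ u) := by
    -- With b = CCᵀa the factor a·b is |Cᵀa|², so the R-term is -2|Gu|²|Cᵀa|² and outweighs the
    -- first term; the mixed term vanishes by AᵀG = 0.
    have h2 := h1 (-(G *ᵥ u)) a (C *ᵥ (Cᵀ *ᵥ a)) (((X * Xᵀ)⁻¹ * X) *ᵥ u)
    have e1 : (G *ᵥ u) ⬝ᵥ (A *ᵥ (C *ᵥ (Cᵀ *ᵥ a))) = 0 := by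
      rw [dotProduct_comm, mulVec_dotProduct, mulVec_mulVec _ Aᵀ G, hAG, zero_mulVec, dotProduct_zero]
    have e2 : a ⬝ᵥ (C *ᵥ (Cᵀ *ᵥ a)) = (Cᵀ *ᵥ a) ⬝ᵥ (Cᵀ *ᵥ a) := by
      rw [mulVec_dotProduct, transpose_transpose]
    have e3 : (R * Xᵀ) *ᵥ (((X * Xᵀ)⁻¹ * X) *ᵥ u) = G *ᵥ u := by
      rw [← mulVec_mulVec, ← rowProj_mulVec, mulVec_mulVec]
    rw [e3, e2, ← rowProj_mulVec, neg_dotProduct, neg_dotProduct, e1, dotProduct_neg,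
      neg_dotProduct] at h2
    have h3 := mul_le_mul_of_nonneg_left (rowProj_contraction hXu u)
      (dotProduct_self_nonneg' (A *ᵥ (C *ᵥ (Cᵀ *ᵥ a))))
    linarith
  obtain ⟨c, hc, hcG, hcA⟩ : ∃ c : ℝ, 0 ≤ c ∧ (∀ u, (G *ᵥ u) ⬝ᵥ (G *ᵥ u) ≤ c * (u ⬝ᵥ u)) ∧
      ∀ a, c * ((Cᵀ *ᵥ a) ⬝ᵥ (Cᵀ *ᵥ a))
        ≤ (A *ᵥ (C *ᵥ (Cᵀ *ᵥ a))) ⬝ᵥ (A *ᵥ (C *ᵥ (Cᵀ *ᵥ a))) := by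
    have hpos (a : {a : m → ℝ // a ≠ 0}) : 0 < (Cᵀ *ᵥ a.1) ⬝ᵥ (Cᵀ *ᵥ a.1) :=
      dotProduct_self_pos' fun h0 => a.2 (hCinj _ h0)
    set q : {a : m → ℝ // a ≠ 0} → ℝ := fun a =>
      ((A *ᵥ (C *ᵥ (Cᵀ *ᵥ a.1))) ⬝ᵥ (A *ᵥ (C *ᵥ (Cᵀ *ᵥ a.1)))) /
        ((Cᵀ *ᵥ a.1) ⬝ᵥ (Cᵀ *ᵥ a.1)) with hq
    have hq0 (a) : 0 ≤ q a := div_nonneg (dotProduct_self_nonneg' _) (hpos a).le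
    have : Nonempty {a : m → ℝ // a ≠ 0} := ⟨⟨fun _ => 1, fun h0 => by
      simpa using congrFun h0 hm.some⟩⟩
    -- This infimum is the squared least singular value of A on the row space of C; by `hcomp` it
    -- dominates every quotient |Gu|²/|u|².
    refine ⟨⨅ a, q a, Real.iInf_nonneg hq0, fun u => ?_, fun a => ?_⟩
    · rcases eq_or_ne u 0 with rfl | hu
      · simp
      rw [← div_le_iff₀ (dotProduct_self_pos' hu)]
      refine le_ciInf fun a => ?_
      rw [hq, div_le_div_iff₀ (dotProduct_self_pos' hu) (hpos a)]
      exact hcomp u a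
    · rcases eq_or_ne a 0 with rfl | ha
      · simp
      rw [← le_div_iff₀ (hpos ⟨a, ha⟩)]
      exact ciInf_le ⟨0, by rintro _ ⟨b, rfl⟩; exact hq0 b⟩ (⟨a, ha⟩ : {a : m → ℝ // a ≠ 0})
  have hrank : (A' * B' * X).rank ≤ Fintype.card m := by
    rw [Matrix.mul_assoc]
    exact (rank_mul_le_left _ _).trans (rank_le_card_width _)
  have hlow := frob_le_of_rank_le hC hAG hGC hc hcG hcA hrank
  -- The rows of YP - Y are orthogonal to those of X, so only the distance to YP depends on Q.
  have hsplit (Q : Matrix k l ℝ) : frob (Q * X - Y) (Q * X - Y)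
      = frob (Q * X - Y * P) (Q * X - Y * P) + frob (Y * P - Y) (Y * P - Y) := by
    have e1 : Q * X - Y = (Q * X - Y * P) + (Y * P - Y) := by abel
    have e2 : Q * X - Y * P = (Q - Y * Xᵀ * (X * Xᵀ)⁻¹) * X := by
      rw [hP, rowProj, Matrix.sub_mul]
      simp only [Matrix.mul_assoc]
    have e3 : frob (Q * X - Y * P) (Y * P - Y) = 0 := by
      rw [frob_comm, e2, frob_mul_right, Matrix.sub_mul, Matrix.mul_assoc Y, hP,
        rowProj_mul_transpose hXu, sub_self]
      simp [frob]
    rw [e1, frob_add_self, e3]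
    ring
  have hG' : A * B * X - Y * P = G := by
    rw [← hM, hCdef, Matrix.mul_assoc]; abel
  rw [hM] at hlow
  rw [hR, hsplit (A * B), hsplit (A' * B'), hG']
  linarith

end MatrixLandscape

lemma transpose_mulVec_injective_of_rank {d N : ℕ} {X : Matrix (Fin d) (Fin N) ℝ}
    (hX : X.rank = d) (w : Fin d → ℝ) (hw : Xᵀ *ᵥ w = 0) : w = 0 := by
  have h1 := LinearMap.finrank_range_add_finrank_ker Xᵀ.mulVecLin
  have h2 : Module.finrank ℝ (LinearMap.range Xᵀ.mulVecLin) = d := by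
    exact (Matrix.rank_transpose X).trans hX
  rw [h2, Module.finrank_fin_fun] at h1
  have h3 : LinearMap.ker Xᵀ.mulVecLin = ⊥ := Submodule.finrank_eq_zero.mp (by omega)
  exact LinearMap.ker_eq_bot'.mp h3 w hw

/-! ### Second derivatives along lines and the Hessian matrix. -/

section SecondDerivative

lemma hasDerivAt_comp_line {E F : Type*} [NormedAddCommGroup E] [NormedSpace ℝ E]
    [NormedAddCommGroup F] [NormedSpace ℝ F] {h : E → F} (hh : Differentiable ℝ h) (x D : E)
    (t : ℝ) : HasDerivAt (fun s : ℝ => h (x + s • D)) (fderiv ℝ h (x + t • D) D) t := by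
  have hl : HasDerivAt (fun s : ℝ => x + s • D) D t := by
    simpa using ((hasDerivAt_id t).smul_const D).const_add x
  exact (hh _).hasFDerivAt.comp_hasDerivAt t hl

lemma fderiv_fderiv_eq_deriv_deriv {E : Type*} [NormedAddCommGroup E]
    [NormedSpace ℝ E] {h : E → ℝ} (hh : ContDiff ℝ 2 h)
    (x D : E) :
    fderiv ℝ (fderiv ℝ h) x D D = deriv (deriv fun s : ℝ => h (x + s • D)) 0 := by
  have hd : Differentiable ℝ (fderiv ℝ h) :=
    (hh.fderiv_right (m := 1) (by norm_num)).differentiable (by norm_num)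
  have h1 : deriv (fun s : ℝ => h (x + s • D)) = fun t => fderiv ℝ h (x + t • D) D :=
    funext fun t => (hasDerivAt_comp_line (hh.differentiable (by norm_num)) x D t).deriv
  have h2 := hasDerivAt_comp_line hd x D 0
  rw [zero_smul, add_zero] at h2
  have h3 : HasDerivAt (fun t : ℝ => fderiv ℝ h (x + t • D) D) (fderiv ℝ (fderiv ℝ h) x D D) 0 := by
    simpa using h2.clm_apply (hasDerivAt_const (0 : ℝ) D)
  rw [h1, h3.deriv]

variable {ι : Type*} [Fintype ι] [DecidableEq ι]

lemma hessian_apply {h : EuclideanSpace ℝ ι → ℝ} (hh : ContDiff ℝ 2 h) (x : EuclideanSpace ℝ ι)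
    (i j : ι) : hessian h x i j =
      fderiv ℝ (fderiv ℝ h) x (EuclideanSpace.single i 1) (EuclideanSpace.single j 1) := by
  have hd : DifferentiableAt ℝ (fderiv ℝ h) x :=
    ((hh.fderiv_right (m := 1) (by norm_num)).differentiable (by norm_num)) x
  simp only [hessian, Matrix.of_apply, partialDeriv]
  have := (hd.hasFDerivAt.clm_apply (hasFDerivAt_const (EuclideanSpace.single j (1 : ℝ)) x)).fderiv
  change fderiv ℝ (fun y => fderiv ℝ h y (EuclideanSpace.single j 1)) x _ = _
  rw [this]
  simp

/-- Symmetry of second derivatives gives access to the spectral theorem, which links the sign of the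
eigenvalues to the quadratic form. -/
lemma hessian_isHermitian {h : EuclideanSpace ℝ ι → ℝ} (hh : ContDiff ℝ 2 h)
    (x : EuclideanSpace ℝ ι) : (hessian h x).IsHermitian := by
  ext i j
  rw [conjTranspose_apply, star_trivial, hessian_apply hh, hessian_apply hh]
  exact (hh.contDiffAt.isSymmSndFDerivAt (by simp)) _ _

lemma fderiv_fderiv_eq_dotProduct {h : EuclideanSpace ℝ ι → ℝ} (hh : ContDiff ℝ 2 h)
    (x D : EuclideanSpace ℝ ι) :
    fderiv ℝ (fderiv ℝ h) x D D = D.ofLp ⬝ᵥ (hessian h x *ᵥ D.ofLp) := by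
  have hD : D = ∑ i, D i • EuclideanSpace.single i (1 : ℝ) := by
    ext j
    simp [Finset.sum_apply, Pi.single_apply]
  conv_lhs => rw [hD]
  simp only [map_sum, map_smul, _root_.sum_apply, _root_.smul_apply,
    ← hessian_apply hh, dotProduct, mulVec, smul_eq_mul, Finset.mul_sum]
  rw [Finset.sum_comm]
  exact Finset.sum_congr rfl fun i _ => Finset.sum_congr rfl fun j _ => by ring

/-- At a critical point that is not a strict saddle, the second derivative is nonnegative. -/
lemma fderiv_fderiv_nonneg_of_not_isStrictSaddle {h : EuclideanSpace ℝ ι → ℝ}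
    (hh : ContDiff ℝ 2 h) {x : EuclideanSpace ℝ ι} (hx : IsCriticalPoint h x)
    (hs : ¬ IsStrictSaddle h x) (D : EuclideanSpace ℝ ι) :
    0 ≤ fderiv ℝ (fderiv ℝ h) x D D := by
  have hH := hessian_isHermitian hh x
  have hpos : (hessian h x).PosSemidef := by
    refine hH.posSemidef_iff_eigenvalues_nonneg.mpr fun i => ?_
    by_contra hneg
    refine hs ⟨hx, hH.eigenvalues i, not_le.mp hneg, ?_⟩
    refine Module.End.hasEigenvalue_of_hasEigenvector (x := (hH.eigenvectorBasis i).ofLp) ⟨?_, ?_⟩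
    · rw [Module.End.mem_eigenspace_iff, toLin'_apply]
      exact hH.mulVec_eigenvectorBasis i
    · intro h0
      exact hH.eigenvectorBasis.orthonormal.ne_zero i (by ext j; exact congrFun h0 j)
  rw [fderiv_fderiv_eq_dotProduct hh]
  simpa using hpos.dotProduct_mulVec_nonneg D.ofLp

end SecondDerivative

/-! ### Quartic polynomials in one variable. -/

section Quartic

variable (p₀ p₁ p₂ p₃ p₄ : ℝ)

lemma deriv_quartic : deriv (fun t : ℝ => p₀ + t * p₁ + t ^ 2 * p₂ + t ^ 3 * p₃ + t ^ 4 * p₄) =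
    fun t => p₁ + 2 * t * p₂ + 3 * t ^ 2 * p₃ + 4 * t ^ 3 * p₄ := by
  funext t
  have h := (((((hasDerivAt_id t).mul_const p₁).const_add p₀).add
    (((hasDerivAt_id t).pow 2).mul_const p₂)).add (((hasDerivAt_id t).pow 3).mul_const p₃)).add
    (((hasDerivAt_id t).pow 4).mul_const p₄)
  refine h.deriv.trans ?_
  simp

lemma deriv_deriv_quartic_zero :
    deriv (deriv fun t : ℝ => p₀ + t * p₁ + t ^ 2 * p₂ + t ^ 3 * p₃ + t ^ 4 * p₄) 0 = 2 * p₂ := by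
  have h := deriv_quartic p₁ (2 * p₂) (3 * p₃) (4 * p₄) 0
  rw [deriv_quartic]
  have e : (fun t : ℝ => p₁ + 2 * t * p₂ + 3 * t ^ 2 * p₃ + 4 * t ^ 3 * p₄) =
      fun t => p₁ + t * (2 * p₂) + t ^ 2 * (3 * p₃) + t ^ 3 * (4 * p₄) + t ^ 4 * 0 := by
    funext t; ring
  rw [e, h]
  simp

/-- Divide the increment by t² and let t tend to 0. -/
lemma nonneg_of_isLocalMin_quartic {p₀ p₂ p₃ p₄ : ℝ}
    (h : IsLocalMin (fun t : ℝ => p₀ + t * 0 + t ^ 2 * p₂ + t ^ 3 * p₃ + t ^ 4 * p₄) 0) :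
    0 ≤ p₂ := by
  have ht : Tendsto (fun t : ℝ => p₂ + t * p₃ + t ^ 2 * p₄) (𝓝[≠] 0) (𝓝 p₂) := by
    have : Continuous fun t : ℝ => p₂ + t * p₃ + t ^ 2 * p₄ := by fun_prop
    simpa using (this.tendsto 0).mono_left nhdsWithin_le_nhds
  refine ge_of_tendsto ht ?_
  filter_upwards [nhdsWithin_le_nhds h, self_mem_nhdsWithin] with t h1 h2
  have h3 : 0 < t ^ 2 := by positivity [show t ≠ 0 from h2]
  refine nonneg_of_mul_nonneg_right ?_ h3
  linarith

end Quartic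

/-! ### The loss as a function on the weight space. -/

section Loss

variable {d₀ d₁ d₂ N : ℕ}

/-- The point of the weight space with the given weight matrices. -/
def weights (B : Matrix (Fin d₁) (Fin d₀) ℝ) (A : Matrix (Fin d₂) (Fin d₁) ℝ) :
    Weights d₀ d₁ d₂ :=
  WithLp.toLp 2 (Sum.elim (fun p => B p.1 p.2) fun p => A p.1 p.2)

lemma W₁_add_smul_weights (Z : Weights d₀ d₁ d₂) (t : ℝ) (U : Matrix (Fin d₁) (Fin d₀) ℝ)
    (V : Matrix (Fin d₂) (Fin d₁) ℝ) : W₁ (Z + t • weights U V) = W₁ Z + t • U := by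
  ext i j
  simp [W₁, weights]

lemma W₂_add_smul_weights (Z : Weights d₀ d₁ d₂) (t : ℝ) (U : Matrix (Fin d₁) (Fin d₀) ℝ)
    (V : Matrix (Fin d₂) (Fin d₁) ℝ) : W₂ (Z + t • weights U V) = W₂ Z + t • V := by
  ext i j
  simp [W₂, weights]

variable (X : Matrix (Fin d₀) (Fin N) ℝ) (Y : Matrix (Fin d₂) (Fin N) ℝ)

lemma loss_eq_frob (Z : Weights d₀ d₁ d₂) :
    loss X Y Z = 1 / 2 * frob (W₂ Z * W₁ Z * X - Y) (W₂ Z * W₁ Z * X - Y) := by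
  rw [loss, frobenius_norm_def, ← Real.sqrt_eq_rpow, Real.sq_sqrt, frob_eq_sum]
  · simp [← pow_two]
  · positivity

/-- The norm need not be smooth at 0, but its square is a polynomial in the weights. -/
lemma contDiff_loss : ContDiff ℝ 2 (loss X Y : Weights d₀ d₁ d₂ → ℝ) := by
  have h : (loss X Y : Weights d₀ d₁ d₂ → ℝ) = fun Z => 1 / 2 * ∑ i, ∑ j,
      (∑ k, (∑ l, Z (Sum.inr (i, l)) * Z (Sum.inl (l, k))) * X k j - Y i j) ^ 2 := by
    funext Z
    rw [loss_eq_frob, frob_eq_sum]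
    simp [Matrix.mul_apply, W₁, W₂, pow_two]
  rw [h]
  fun_prop

/-- The loss along a line is a quartic polynomial. -/
lemma loss_line (Z : Weights d₀ d₁ d₂) (U : Matrix (Fin d₁) (Fin d₀) ℝ)
    (V : Matrix (Fin d₂) (Fin d₁) ℝ) :
    ∃ p₃ p₄ : ℝ, (fun t : ℝ => loss X Y (Z + t • weights U V)) = fun t => loss X Y Z
      + t * frob (W₂ Z * W₁ Z * X - Y) ((V * W₁ Z + W₂ Z * U) * X)
      + t ^ 2 * (1 / 2 * (frob ((V * W₁ Z + W₂ Z * U) * X) ((V * W₁ Z + W₂ Z * U) * X)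
        + 2 * frob (W₂ Z * W₁ Z * X - Y) (V * U * X))) + t ^ 3 * p₃ + t ^ 4 * p₄ := by
  set R := W₂ Z * W₁ Z * X - Y with hR
  set L := (V * W₁ Z + W₂ Z * U) * X with hL
  set K := V * U * X with hK
  -- Along the line the residual is R + tL + t²K; half its squared norm has these top coefficients.
  refine ⟨frob L K, 1 / 2 * frob K K, ?_⟩
  funext t
  have e : W₂ (Z + t • weights U V) * W₁ (Z + t • weights U V) * X - Y
      = R + (t • L + t ^ 2 • K) := by
    rw [W₁_add_smul_weights, W₂_add_smul_weights, hR, hL, hK]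
    simp only [Matrix.add_mul, Matrix.mul_add, Matrix.smul_mul, Matrix.mul_smul, smul_smul,
      smul_add, pow_two]
    abel
  rw [loss_eq_frob, loss_eq_frob, e, frob_add_self, frob_add_self, ← hR]
  simp only [frob_add_right, frob_smul_left, frob_smul_right]
  ring

variable {X Y}

lemma frob_eq_zero_of_isCriticalPoint {Z : Weights d₀ d₁ d₂} (hZ : IsCriticalPoint (loss X Y) Z)
    (U : Matrix (Fin d₁) (Fin d₀) ℝ) (V : Matrix (Fin d₂) (Fin d₁) ℝ) :
    frob (W₂ Z * W₁ Z * X - Y) ((V * W₁ Z + W₂ Z * U) * X) = 0 := by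
  obtain ⟨p₃, p₄, h⟩ := loss_line X Y Z U V
  have h1 := (hasDerivAt_comp_line ((contDiff_loss X Y).differentiable (by norm_num)) Z
    (weights U V) 0).deriv
  have h2 : fderiv ℝ (loss X Y) Z = 0 := by
    simpa using (hasGradientAt_iff_hasFDerivAt.mp hZ).fderiv
  rw [h, deriv_quartic, zero_smul, add_zero, h2] at h1
  simpa using h1

/-- A critical point of the loss with nonnegative second-order terms is a global minimum. -/
lemma isGlobalMin_of_second_order (hX : X.rank = d₀) {Z : Weights d₀ d₁ d₂}
    (hZ : IsCriticalPoint (loss X Y) Z)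
    (h : ∀ (U : Matrix (Fin d₁) (Fin d₀) ℝ) (V : Matrix (Fin d₂) (Fin d₁) ℝ),
      0 ≤ frob ((V * W₁ Z + W₂ Z * U) * X) ((V * W₁ Z + W₂ Z * U) * X)
        + 2 * frob (W₂ Z * W₁ Z * X - Y) (V * U * X)) :
    IsGlobalMin (loss X Y) Z := by
  intro Z'
  rw [loss_eq_frob, loss_eq_frob]
  refine mul_le_mul_of_nonneg_left
    (frob_le_of_second_order (transpose_mulVec_injective_of_rank hX) ?_ ?_ h _ _) (by norm_num)
  -- Varying one layer at a time by rank-one matrices yields the two matrix equations of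
  -- criticality.
  · refine eq_zero_of_forall_dotProduct_mulVec fun v u => ?_
    have := frob_eq_zero_of_isCriticalPoint hZ (vecMulVec v u) 0
    rwa [Matrix.zero_mul, zero_add, frob_mul_right, frob_mul_left, frob_vecMulVec_right] at this
  · refine eq_zero_of_forall_dotProduct_mulVec fun v u => ?_
    have := frob_eq_zero_of_isCriticalPoint hZ 0 (vecMulVec v u)
    rwa [Matrix.mul_zero, add_zero, frob_mul_right, frob_mul_right, frob_vecMulVec_right] at this

lemma isGlobalMin_of_isLocalMin (hX : X.rank = d₀) {Z : Weights d₀ d₁ d₂}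
    (hZ : IsCriticalPoint (loss X Y) Z) (hmin : IsLocalMin (loss X Y) Z) :
    IsGlobalMin (loss X Y) Z := by
  refine isGlobalMin_of_second_order hX hZ fun U V => ?_
  obtain ⟨p₃, p₄, h⟩ := loss_line X Y Z U V
  have hc : Continuous fun t : ℝ => Z + t • weights U V := by fun_prop
  have hl : IsLocalMin (fun t : ℝ => loss X Y (Z + t • weights U V)) 0 := by
    have h0 : Tendsto (fun t : ℝ => Z + t • weights U V) (𝓝 0) (𝓝 Z) := by
      simpa using hc.tendsto 0
    filter_upwards [h0.eventually hmin] with t ht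
    simpa using ht
  rw [h, frob_eq_zero_of_isCriticalPoint hZ] at hl
  linarith [nonneg_of_isLocalMin_quartic hl]

lemma isGlobalMin_or_isStrictSaddle (hX : X.rank = d₀) {Z : Weights d₀ d₁ d₂}
    (hZ : IsCriticalPoint (loss X Y) Z) :
    IsGlobalMin (loss X Y) Z ∨ IsStrictSaddle (loss X Y) Z := by
  by_cases hs : IsStrictSaddle (loss X Y) Z
  · exact Or.inr hs
  refine Or.inl (isGlobalMin_of_second_order hX hZ fun U V => ?_)
  obtain ⟨p₃, p₄, h⟩ := loss_line X Y Z U V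
  have h1 := fderiv_fderiv_nonneg_of_not_isStrictSaddle (contDiff_loss X Y) hZ hs (weights U V)
  rw [fderiv_fderiv_eq_deriv_deriv (contDiff_loss X Y), h, deriv_deriv_quartic_zero] at h1
  linarith

end Loss

end LinearNetwork

theorem theorem2 (d₀ d₁ d₂ N : ℕ)
    (X : Matrix (Fin d₀) (Fin N) ℝ) (Y : Matrix (Fin d₂) (Fin N) ℝ)
    (hX : X.rank = d₀) :
    (∀ Z : LinearNetwork.Weights d₀ d₁ d₂,
      ¬ LinearNetwork.IsSpuriousLocalMin (LinearNetwork.loss X Y) Z) ∧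
    LinearNetwork.HasStrictSaddleProperty
      (LinearNetwork.loss X Y : LinearNetwork.Weights d₀ d₁ d₂ → ℝ) ∧
    (∀ Z : LinearNetwork.Weights d₀ d₁ d₂,
      LinearNetwork.IsCriticalPoint (LinearNetwork.loss X Y) Z →
        LinearNetwork.IsGlobalMin (LinearNetwork.loss X Y) Z ∨
          LinearNetwork.IsStrictSaddle (LinearNetwork.loss X Y) Z) := by
  refine ⟨fun Z hZ => hZ.2.2 (LinearNetwork.isGlobalMin_of_isLocalMin hX hZ.1 hZ.2.1),
    ⟨LinearNetwork.contDiff_loss X Y, fun Z hZ => ?_⟩,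
    fun Z hZ => LinearNetwork.isGlobalMin_or_isStrictSaddle hX hZ⟩
  exact (LinearNetwork.isGlobalMin_or_isStrictSaddle hX hZ).imp_left
    fun h => Filter.Eventually.of_forall h
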